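/- Let $W$ be a finite Weyl group with set $S$ of simple reflections and length function $\ell$. Let $\mathbb{A}=\mathbb{Z}[v,v^{-1}]$, and let $\mathbf{H}$ be the Hecke algebra of $(W,S)$, that is, the unital associative $\mathbb{A}$-algebra generated by $H_s$, $s\in S$, subject to the braid relations of $(W,S)$ and $H_s^2=1+(v^{-1}-v)H_s$ for $s\in S$. For $w\in W$ put $H_w=H_{s_1}\cdots H_{s_k}$, where $w=s_1\cdots s_k$ is any reduced expression. The bar involution is the ring involution of $\mathbf{H}$ with $\overline{v}=v^{-1}$ and $\overline{H_s}=H_s^{-1}$. The Kazhdan-Lusztig basis $\{\underline{H}_w : w\in W\}$ of $\mathbf{H}$ is uniquely determined by $\overline{\underline{H}_w}=\underline{H}_w$ and $\underline{H}_w\in H_w+\sum_{x\in W}v\mathbb{Z}[v]H_x$. For $x,y\in W$ write $y\geq_L x$ if there is $u\in W$ such that $\underline{H}_y$ appears with a non-zero coefficient in the expression of $\underline{H}_u\underline{H}_x$ in the Kazhdan-Lusztig basis. For $w\in W$, let $\mathbf{LM}_w$ be the $\mathbb{A}$-span of all $\underline{H}_x$ with $x\geq_L w$. Let $w\in W$ be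 such that $$\{x\in W : x\geq_L w\}=\{y\in W : y=aw \text{ for some } a\in W \text{ such that } \ell(aw)=\ell(a)+\ell(w)\}.$$ Then $\mathbf{H}\underline{H}_w=\mathbf{LM}_w$. -/

import Mathlib

namespace KazhdanLusztig

open Polynomial LaurentPolynomial

/-- The ring `𝔸 = ℤ[v, v⁻¹]` of integral Laurent polynomials. -/
abbrev LaurentRing : Type := LaurentPolynomial ℤ

/-- The element `v` of `ℤ[v, v⁻¹]`. -/
noncomputable abbrev v : LaurentRing := T 1

/-- The element `v⁻¹` of `ℤ[v, v⁻¹]`. -/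
noncomputable abbrev vInv : LaurentRing := T (-1)

variable {B : Type*} (M : CoxeterMatrix B)

/-- The defining relations of the Hecke algebra, on the free `ℤ[v, v⁻¹]`-algebra on the set of
simple reflections: the braid relations `s t s ⋯ = t s t ⋯` (with `M s t` factors on both sides;
this is the trivial relation `1 = 1` if `M s t = 0`, that is, if `s t` has infinite order), and
the quadratic relations `s² = 1 + (v⁻¹ - v) s`. -/
inductive HeckeRel : FreeAlgebra LaurentRing B → FreeAlgebra LaurentRing B → Prop
  | braid (i j : B) :
      HeckeRel
        (((CoxeterSystem.braidWord M i j).map (FreeAlgebra.ι LaurentRing)).prod)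
        (((CoxeterSystem.braidWord M j i).map (FreeAlgebra.ι LaurentRing)).prod)
  | quadratic (i : B) :
      HeckeRel
        (FreeAlgebra.ι LaurentRing i * FreeAlgebra.ι LaurentRing i)
        (1 + (vInv - v) • FreeAlgebra.ι LaurentRing i)

/-- The Hecke algebra `𝐇` over `ℤ[v, v⁻¹]`, by generators and relations. -/
def HeckeAlgebra : Type _ := RingQuot (HeckeRel M)

noncomputable instance : Ring (HeckeAlgebra M) :=
  inferInstanceAs (Ring (RingQuot (HeckeRel M)))

noncomputable instance : Algebra LaurentRing (HeckeAlgebra M) :=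
  inferInstanceAs (Algebra LaurentRing (RingQuot (HeckeRel M)))

/-- The quotient map from the free algebra. -/
noncomputable def heckeMk : FreeAlgebra LaurentRing B →ₐ[LaurentRing] HeckeAlgebra M :=
  RingQuot.mkAlgHom LaurentRing (HeckeRel M)

/-- The generator `H_s`. -/
noncomputable def heckeGen (i : B) : HeckeAlgebra M := heckeMk M (FreeAlgebra.ι LaurentRing i)

theorem heckeGen_braid (i j : B) :
    ((CoxeterSystem.braidWord M i j).map (heckeGen M)).prod =
      ((CoxeterSystem.braidWord M j i).map (heckeGen M)).prod := by
  have h : heckeMk M _ = heckeMk M _ :=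
    RingQuot.mkAlgHom_rel LaurentRing (HeckeRel.braid (M := M) i j)
  rw [map_list_prod, map_list_prod, List.map_map, List.map_map] at h
  exact h

theorem heckeGen_mul_self (i : B) :
    heckeGen M i * heckeGen M i = 1 + (vInv - v) • heckeGen M i := by
  have h : heckeMk M _ = heckeMk M _ :=
    RingQuot.mkAlgHom_rel LaurentRing (HeckeRel.quadratic (M := M) i)
  rw [map_mul, map_add, map_one, map_smul] at h
  exact h

/-- The generator `H_s` as an invertible element, with inverse `H_s - (v⁻¹ - v)`. -/
noncomputable def heckeUnit (i : B) : (HeckeAlgebra M)ˣ where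
  val := heckeGen M i
  inv := heckeGen M i - (vInv - v) • 1
  val_inv := by
    rw [mul_sub, heckeGen_mul_self, mul_smul_comm, mul_one, add_sub_cancel_right]
  inv_val := by
    rw [sub_mul, heckeGen_mul_self, smul_mul_assoc, one_mul, add_sub_cancel_right]

/-- The ring homomorphism `ℤ[v, v⁻¹] → 𝐇`, `p(v) ↦ p(v⁻¹) · 1`. -/
noncomputable def barScalar : LaurentRing →+* HeckeAlgebra M :=
  (algebraMap LaurentRing (HeckeAlgebra M)).comp
    (LaurentPolynomial.invert (R := ℤ)).toRingEquiv.toRingHom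

/-- The algebra structure on `𝐇` for which `v` acts as multiplication by `v⁻¹`; it is used only
to construct the bar involution, and it is not an instance. -/
noncomputable abbrev barAlgebra : Algebra LaurentRing (HeckeAlgebra M) :=
  (barScalar M).toAlgebra' fun c x =>
    Algebra.commutes (A := HeckeAlgebra M) (LaurentPolynomial.invert c) x

/-- The ring homomorphism from the free algebra to `𝐇` with `v ↦ v⁻¹` and `s ↦ H_s⁻¹`. -/
noncomputable def barFree : FreeAlgebra LaurentRing B →+* HeckeAlgebra M :=
  letI := barAlgebra M
  (FreeAlgebra.lift LaurentRing
    fun i => (((heckeUnit M i)⁻¹ : (HeckeAlgebra M)ˣ) : HeckeAlgebra M)).toRingHom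

theorem barFree_ι (i : B) :
    barFree M (FreeAlgebra.ι LaurentRing i) =
      (((heckeUnit M i)⁻¹ : (HeckeAlgebra M)ˣ) : HeckeAlgebra M) := by
  let := barAlgebra M
  exact FreeAlgebra.lift_ι_apply (R := LaurentRing)
    (fun i => (((heckeUnit M i)⁻¹ : (HeckeAlgebra M)ˣ) : HeckeAlgebra M)) i

theorem barFree_algebraMap (a : LaurentRing) :
    barFree M (algebraMap LaurentRing _ a) =
      algebraMap LaurentRing (HeckeAlgebra M) (LaurentPolynomial.invert a) := by
  let := barAlgebra M
  exact AlgHom.commutes (FreeAlgebra.lift LaurentRing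
    fun i => (((heckeUnit M i)⁻¹ : (HeckeAlgebra M)ˣ) : HeckeAlgebra M)) a

theorem prod_map_inv_heckeUnit (l : List B) :
    (l.map fun i => (heckeUnit M i)⁻¹).prod = ((l.reverse.map (heckeUnit M)).prod)⁻¹ := by
  rw [List.prod_inv_reverse, List.map_reverse, List.map_reverse, List.reverse_reverse,
    List.map_map]
  rfl

theorem reverse_alternatingWord (i j : B) (m : ℕ) :
    (CoxeterSystem.alternatingWord i j m).reverse =
      if Even m then CoxeterSystem.alternatingWord j i m
      else CoxeterSystem.alternatingWord i j m := by
  induction m generalizing i j with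
  | zero => simp [CoxeterSystem.alternatingWord]
  | succ m ih =>
    have h := CoxeterSystem.alternatingWord_succ' i j m
    rw [CoxeterSystem.alternatingWord_succ, List.concat_eq_append, List.reverse_append, ih]
    by_cases hm : Even m
    · rw [if_pos hm] at h
      have hm' : ¬ Even (m + 1) := by simpa [Nat.even_add_one] using hm
      have h2 := CoxeterSystem.alternatingWord_succ i j m
      rw [h, List.concat_eq_append] at h2
      rw [if_pos hm, if_neg hm']
      exact h2
    · have hm' : Even (m + 1) := by simpa [Nat.even_add_one] using hm
      rw [if_neg hm, if_pos hm', CoxeterSystem.alternatingWord_succ', if_neg hm]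
      rfl

theorem heckeUnit_braid (i j : B) :
    ((CoxeterSystem.braidWord M i j).map (heckeUnit M)).prod =
      ((CoxeterSystem.braidWord M j i).map (heckeUnit M)).prod := by
  have key : ∀ l : List B, (((l.map (heckeUnit M)).prod : (HeckeAlgebra M)ˣ) : HeckeAlgebra M) =
      (l.map (heckeGen M)).prod := fun l => by
    rw [← Units.coeHom_apply, map_list_prod, List.map_map]
    rfl
  apply Units.ext
  rw [key, key, heckeGen_braid]

theorem heckeUnit_inv_braid (i j : B) :
    ((CoxeterSystem.braidWord M i j).map fun k => (heckeUnit M k)⁻¹).prod =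
      ((CoxeterSystem.braidWord M j i).map fun k => (heckeUnit M k)⁻¹).prod := by
  rw [prod_map_inv_heckeUnit, prod_map_inv_heckeUnit, inv_inj]
  have h := heckeUnit_braid M i j
  unfold CoxeterSystem.braidWord at h ⊢
  rw [M.symmetric j i] at h ⊢
  rw [reverse_alternatingWord, reverse_alternatingWord]
  split_ifs
  · exact h.symm
  · exact h

theorem barFree_rel {x y : FreeAlgebra LaurentRing B} (h : HeckeRel M x y) :
    barFree M x = barFree M y := by
  induction h with
  | braid i j =>
    have key : ∀ l : List B, barFree M ((l.map (FreeAlgebra.ι LaurentRing)).prod) =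
        (((l.map fun k => (heckeUnit M k)⁻¹).prod : (HeckeAlgebra M)ˣ) : HeckeAlgebra M) := by
      intro l
      induction l with
      | nil => simp
      | cons a l ih => simp [barFree_ι, ih]
    rw [key, key, heckeUnit_inv_braid]
  | quadratic i =>
    have h1 : ((heckeUnit M i)⁻¹ : (HeckeAlgebra M)ˣ).val =
        heckeGen M i - (vInv - v) • 1 := rfl
    have h2 : LaurentPolynomial.invert (vInv - v) = v - vInv := by simp
    rw [Algebra.smul_def, map_mul, map_add, map_one, map_mul, barFree_ι, barFree_algebraMap,
      h1, h2, ← Algebra.smul_def]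
    rw [sub_mul, mul_sub, heckeGen_mul_self, smul_mul_assoc, one_mul, mul_smul_comm, mul_one,
      add_sub_cancel_right, smul_sub, smul_smul, smul_sub, smul_smul]
    rw [show (v - vInv) * (vInv - v) = -((vInv - v) * (vInv - v)) by ring,
      show v - vInv = -(vInv - v) by ring, neg_smul, neg_smul]
    abel

/-- The bar involution of the Hecke algebra: the ring homomorphism with `v ↦ v⁻¹` and
`H_s ↦ H_s⁻¹`. -/
noncomputable def bar : HeckeAlgebra M →+* HeckeAlgebra M :=
  RingQuot.lift ⟨barFree M, fun _ _ h => barFree_rel M h⟩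

theorem bar_heckeMk (x : FreeAlgebra LaurentRing B) : bar M (heckeMk M x) = barFree M x := by
  have h : heckeMk M x = RingQuot.mkRingHom (HeckeRel M) x := by
    unfold heckeMk
    rw [← RingQuot.mkAlgHom_coe LaurentRing (HeckeRel M)]
    rfl
  rw [h]
  exact RingQuot.lift_mkRingHom_apply (barFree M) (fun _ _ h => barFree_rel M h) x

theorem bar_heckeGen (i : B) :
    bar M (heckeGen M i) = (((heckeUnit M i)⁻¹ : (HeckeAlgebra M)ˣ) : HeckeAlgebra M) := by
  rw [heckeGen, bar_heckeMk, barFree_ι]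

theorem bar_algebraMap (a : LaurentRing) :
    bar M (algebraMap LaurentRing _ a) =
      algebraMap LaurentRing (HeckeAlgebra M) (LaurentPolynomial.invert a) := by
  rw [← (heckeMk M).commutes, bar_heckeMk, barFree_algebraMap]

variable {M} {W : Type*} [Group W] (cs : CoxeterSystem M W)

/-- The standard basis element `H_w = H_{s₁} ⋯ H_{sₖ}`, for a reduced expression
`w = s₁ ⋯ sₖ` (the product does not depend on the reduced expression that is chosen here). -/
noncomputable def stdBasis (w : W) : HeckeAlgebra M :=
  ((cs.exists_isReduced w).choose.map (heckeGen M)).prod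

/-- The two properties that characterize the Kazhdan-Lusztig basis element at `w`: it is
invariant under the bar involution, and it lies in `H_w + ∑_y v ℤ[v] H_y`. -/
def IsKLElement (w : W) (C : HeckeAlgebra M) : Prop :=
  bar M C = C ∧
    ∃ q : W →₀ ℤ[X],
      C = stdBasis cs w + q.sum fun y p => (toLaurent (X * p) : LaurentRing) • stdBasis cs y

/-- The Kazhdan-Lusztig basis element `H̲_w`: the unique element of the Hecke algebra that
satisfies `IsKLElement cs w`. -/
noncomputable def klBasis (w : W) : HeckeAlgebra M :=
  Classical.epsilon (IsKLElement cs w)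

/-- The left Kazhdan-Lusztig pre-order `x ≤_L y`: for some `u`, the element `H̲_y` appears with a
non-zero coefficient in the expression of `H̲_u H̲_x` in the Kazhdan-Lusztig basis. -/
def LeftLE (x y : W) : Prop :=
  ∃ u : W, ∃ c : W →₀ LaurentRing,
    klBasis cs u * klBasis cs x = Finsupp.linearCombination LaurentRing (klBasis cs) c ∧ c y ≠ 0

/-- `LM_w`, the `ℤ[v, v⁻¹]`-span of all `H̲_x` with `x ≥_L w`. -/
noncomputable def leftSpan (w : W) : Submodule LaurentRing (HeckeAlgebra M) :=
  Submodule.span LaurentRing (klBasis cs '' {x : W | LeftLE cs w x})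

end KazhdanLusztig

/-!
The inclusion of the left ideal `𝐇 H̲_w` in the span of all `H̲_x` with `x ≥_L w` holds for every
`w`: as the `H̲_u` span `𝐇`, it is the definition of the pre-order (`span_klBasis_le_leftSpan`).

For the other inclusion the point is that the Kazhdan-Lusztig basis is unitriangular over the
standard basis with respect to the length. Hence, if `ℓ(aw) = ℓ(a) + ℓ(w)`, then `H̲_a H̲_w` is
`H̲_{aw}` plus a combination of elements `H̲_y` with `ℓ(y) < ℓ(aw)`
(`klBasis_mul_klBasis_sub_mem`). All `y` that occur satisfy `y ≥_L w` by definition, so by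
hypothesis they are again of the form `y = bw` with `ℓ(bw) = ℓ(b) + ℓ(w)`. By induction on the
length, all `H̲_{aw}` lie in the left ideal generated by `H̲_w` (`leftSpan_le_span_klBasis`).

The rest establishes the structure of the Hecke algebra that this argument uses.

* The parity of the number of times that a reflection occurs in the inversion sequence of a word
  depends only on the element of `W` (`invParity_eq_of_wordProd_eq`); this yields the exchange
  condition. A reflection representation over `ℝ` shows that `s_i s_j` has order exactly `M i j`
  (`simple_mul_simple_pow_ne_one`). Together they give Matsumoto's theorem
  (`prod_map_eq_of_isReduced`), so that the elements `H_w` are well defined and span `𝐇`.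
* The `H_w` are linearly independent because `𝐇` acts on the free module on `W`: the candidates for
  left and right multiplications commute, and an operator commuting with all right multiplications
  is determined by its value at `1`, which reduces the braid relations to the equality of two
  elements of `W` (`prod_leftOp_braid`).
* The Kazhdan-Lusztig elements are constructed by the usual induction: multiply by `H_s + v` and
  subtract a bar invariant element that corrects the constant terms
  (`exists_isTriangularKLElement`). The construction respects the length, and by uniqueness
  (`IsKLElement.unique`) it produces the chosen elements `klBasis`.
-/

namespace CoxeterSystem

open List

variable {B W : Type*} [Group W] {M : CoxeterMatrix B} (cs : CoxeterSystem M W)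

/-! ### The action of a Coxeter group on signed reflections -/

/-- The number, modulo `2`, of occurrences of `t` in the right inversion sequence of a word. -/
noncomputable def invParity (ω : List B) (t : W) : ZMod 2 :=
  open Classical in ((cs.rightInvSeq ω).count t : ZMod 2)

theorem invParity_nil (t : W) : cs.invParity [] t = 0 := by simp [invParity]

open Classical in
theorem invParity_cons (i : B) (ω : List B) (t : W) :
    cs.invParity (i :: ω) t = cs.invParity ω t +
      if (cs.wordProd ω)⁻¹ * cs.simple i * cs.wordProd ω = t then 1 else 0 := by
  simp only [invParity, rightInvSeq, count_cons, beq_iff_eq]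
  push_cast
  rfl

theorem conj_simple_eq_iff (i : B) (x y : W) :
    cs.simple i * x * cs.simple i = y ↔ x = cs.simple i * y * cs.simple i := by
  constructor <;> rintro rfl <;> simp [mul_assoc]

open Classical in
theorem invParity_concat (ω : List B) (i : B) (t : W) :
    cs.invParity (ω.concat i) t = cs.invParity ω (cs.simple i * t * cs.simple i) +
      if t = cs.simple i then 1 else 0 := by
  have h : ∀ l : List W, (l.map (MulAut.conj (cs.simple i))).count t =
      l.count (cs.simple i * t * cs.simple i) := by
    intro l
    conv_lhs => rw [show t = MulAut.conj (cs.simple i) (cs.simple i * t * cs.simple i) by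
      simp [mul_assoc]]
    exact count_map_of_injective _ _ (MulEquiv.injective _) _
  rw [invParity, rightInvSeq_concat, concat_eq_append, count_append, h, count_singleton]
  simp only [invParity, beq_iff_eq, eq_comm (a := t)]
  push_cast
  rfl

open Classical in
/-- The simple reflection `s` acts on `W × ℤ/2` by conjugation on the first factor, changing
the sign at `s` itself. Only the part of `W` formed by the reflections matters, but it is harmless
to let the action be defined everywhere. -/
noncomputable def signedConj (i : B) : Function.End (W × ZMod 2) :=
  fun p => (cs.simple i * p.1 * cs.simple i, p.2 + if p.1 = cs.simple i then 1 else 0)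

theorem prod_map_signedConj (ω : List B) (t : W) (e : ZMod 2) :
    (ω.map cs.signedConj).prod (t, e) =
      (cs.wordProd ω * t * (cs.wordProd ω)⁻¹, e + cs.invParity ω t) := by
  induction ω using List.reverseRecOn generalizing t e with
  | nil => simp [invParity_nil, Function.End.one_def]
  | append_singleton ω i ih =>
    rw [← concat_eq_append, invParity_concat, concat_eq_append, map_append, prod_append,
      wordProd_append]
    change (ω.map cs.signedConj).prod (([i].map cs.signedConj).prod (t, e)) = _
    rw [map_singleton, prod_singleton]
    simp only [signedConj, ih, wordProd_singleton, Prod.mk.injEq]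
    refine ⟨by simp [mul_assoc], by ring⟩

open Classical in
theorem invParity_alternatingWord (i j : B) (q : ℕ) (t : W) :
    cs.invParity (alternatingWord i j q) t =
      ∑ n ∈ Finset.range q,
        if t = cs.simple j * (cs.simple i * cs.simple j) ^ n then 1 else 0 := by
  induction q generalizing i j t with
  | zero => simp [alternatingWord, invParity_nil]
  | succ q ih =>
    rw [alternatingWord_succ, invParity_concat, ih, Finset.sum_range_succ']
    simp only [pow_zero, mul_one]
    congr 1
    refine Finset.sum_congr rfl fun n _ => ?_
    rw [conj_simple_eq_iff, pow_succ]
    have h : cs.simple j * (cs.simple i * (cs.simple j * cs.simple i) ^ n) * cs.simple j =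
        cs.simple j * ((cs.simple i * cs.simple j) ^ n * (cs.simple i * cs.simple j)) := by
      rw [mul_assoc, mul_right_inj, ← mul_pow_mul, mul_assoc]
    rw [h]

theorem pow_eq_prod_alternatingWord {G : Type*} [Monoid G] (f : B → G) (i j : B) (m : ℕ) :
    (f i * f j) ^ m = ((alternatingWord i j (2 * m)).map f).prod := by
  induction m with
  | zero => simp [alternatingWord]
  | succ m ih =>
    rw [show 2 * (m + 1) = 2 * m + 1 + 1 by ring, alternatingWord_succ, alternatingWord_succ,
      pow_succ, ih]
    simp

theorem isLiftable_signedConj : M.IsLiftable cs.signedConj := by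
  classical
  intro i j
  rw [pow_eq_prod_alternatingWord]
  funext ⟨t, e⟩
  rw [prod_map_signedConj, wordProd, ← pow_eq_prod_alternatingWord, simple_mul_simple_pow,
    invParity_alternatingWord, two_mul, Finset.sum_range_add]
  -- The `n`-th and the `(M i j + n)`-th summand agree, so that the sum vanishes modulo `2`.
  simp only [pow_add, simple_mul_simple_pow, one_mul, CharTwo.add_self_eq_zero]
  simp [Function.End.one_def]

/-- The parity of the multiplicity of `t` among the inversions of a word depends only on the
element of `W` that the word represents. -/
theorem invParity_eq_of_wordProd_eq {ω ω' : List B} (h : cs.wordProd ω = cs.wordProd ω') (t : W) :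
    cs.invParity ω t = cs.invParity ω' t := by
  have key : ∀ ω : List B, (ω.map cs.signedConj).prod =
      cs.lift ⟨_, cs.isLiftable_signedConj⟩ (cs.wordProd ω) := by
    intro ω
    rw [wordProd, map_list_prod, map_map]
    congr 2
    funext i
    exact (cs.lift_apply_simple cs.isLiftable_signedConj i).symm
  have h2 : (ω.map cs.signedConj).prod (t, 0) = (ω'.map cs.signedConj).prod (t, 0) := by
    rw [key, key, h]
  rw [prod_map_signedConj, prod_map_signedConj] at h2
  simpa using congrArg Prod.snd h2

/-! ### The exchange condition -/

theorem invParity_ne_zero_of_isRightDescent {ω : List B} {i : B}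
    (h : cs.IsRightDescent (cs.wordProd ω) i) : cs.invParity ω (cs.simple i) ≠ 0 := by
  classical
  intro h0
  obtain ⟨ω', hω', hprod⟩ := cs.exists_isReduced (cs.wordProd ω * cs.simple i)
  have h1 : cs.invParity ω' (cs.simple i) = 1 := by
    rw [← cs.invParity_eq_of_wordProd_eq ((cs.wordProd_concat i ω).trans hprod), invParity_concat]
    simp [h0]
  have hmem : cs.simple i ∈ cs.rightInvSeq ω' := by
    by_contra hn
    rw [invParity, count_eq_zero_of_not_mem hn] at h1
    simp at h1
  have h2 := (cs.isRightInversion_of_mem_rightInvSeq hω' hmem).2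
  rw [← hprod, simple_mul_simple_cancel_right] at h2
  exact absurd h (not_lt_of_gt h2)

theorem isRightDescent_iff_invParity {ω : List B} {i : B} :
    cs.IsRightDescent (cs.wordProd ω) i ↔ cs.invParity ω (cs.simple i) = 1 := by
  have h01 : ∀ a : ZMod 2, a ≠ 0 → a = 1 := by decide
  refine ⟨fun h => h01 _ (cs.invParity_ne_zero_of_isRightDescent h), fun h => ?_⟩
  by_contra hn
  rw [isRightDescent_iff_not_isRightDescent_mul, not_not, ← wordProd_concat] at hn
  apply cs.invParity_ne_zero_of_isRightDescent hn
  rw [invParity_concat]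
  rw [simple_mul_simple_self, one_mul, h, if_pos rfl, CharTwo.add_self_eq_zero]

/-- The exchange condition. -/
theorem exists_eraseIdx_of_isRightDescent {ω : List B} {i : B}
    (h : cs.IsRightDescent (cs.wordProd ω) i) :
    ∃ k < ω.length, cs.wordProd ω * cs.simple i = cs.wordProd (ω.eraseIdx k) := by
  classical
  have hmem : cs.simple i ∈ cs.rightInvSeq ω := by
    by_contra hn
    apply cs.invParity_ne_zero_of_isRightDescent h
    rw [invParity, count_eq_zero_of_not_mem hn, Nat.cast_zero]
  obtain ⟨k, hk, hk'⟩ := List.mem_iff_getElem.mp hmem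
  refine ⟨k, by simpa using hk, ?_⟩
  rw [← wordProd_mul_getD_rightInvSeq, List.getD_eq_getElem _ _ hk, hk']

theorem isRightDescent_simple_mul_iff {w : W} {i j : B}
    (h : cs.simple i * w ≠ w * cs.simple j) :
    cs.IsRightDescent (cs.simple i * w) j ↔ cs.IsRightDescent w j := by
  obtain ⟨ω, rfl⟩ := cs.wordProd_surjective w
  rw [← wordProd_cons, isRightDescent_iff_invParity, isRightDescent_iff_invParity, invParity_cons,
    if_neg, add_zero]
  intro h'
  exact h (by rw [← h']; group)

theorem isLeftDescent_mul_simple_iff {w : W} {i j : B}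
    (h : cs.simple i * w ≠ w * cs.simple j) :
    cs.IsLeftDescent (w * cs.simple j) i ↔ cs.IsLeftDescent w i := by
  rw [← isRightDescent_inv_iff, ← cs.isRightDescent_inv_iff (w := w), mul_inv_rev, inv_simple]
  apply isRightDescent_simple_mul_iff
  intro h'
  apply h
  simpa using (congrArg (·⁻¹) h').symm

/-- If `s w = w t` for simple reflections `s`, `t`, then `s` is a left descent of `w` exactly when
`t` is a right descent of `w`. -/
theorem isLeftDescent_iff_isRightDescent_of_eq {w : W} {i j : B}
    (h : cs.simple i * w = w * cs.simple j) : cs.IsLeftDescent w i ↔ cs.IsRightDescent w j := by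
  rw [IsLeftDescent, IsRightDescent, h]

/-! ### The order of a product of two simple reflections -/

/-- A Cartan coefficient `-2 cos (π / m)`, for `m ∈ {1, 2, 3, 4, 6}` (junk values otherwise). -/
noncomputable def cartanCoeff (m : ℕ) : ℝ :=
  if m = 1 then 2 else if m = 2 then 0 else if m = 3 then -1 else if m = 4 then -√2 else -√3

/-- The simple reflection `i` in the dual geometric representation: a linear form on the
root space is given by its values at the simple roots. -/
noncomputable def dualReflection (M : CoxeterMatrix B) (i : B) : Function.End (B → ℝ) :=
  fun f k => f k - cartanCoeff (M i k) * f i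

theorem dualReflection_mul_apply (i j k : B) (f : B → ℝ) :
    (dualReflection M i * dualReflection M j) f k =
      f k - cartanCoeff (M j k) * f j -
        cartanCoeff (M i k) * (f i - cartanCoeff (M i j) * f j) := by
  change dualReflection M i (dualReflection M j f) k = _
  simp only [dualReflection, M.symmetric j i]

theorem dualReflection_mul_apply_fst (i j : B) (f : B → ℝ) :
    (dualReflection M i * dualReflection M j) f i =
      -f i + cartanCoeff (M i j) * f j := by
  rw [dualReflection_mul_apply, M.diagonal, M.symmetric j i, show cartanCoeff 1 = 2 by
    simp [cartanCoeff]]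
  ring

theorem dualReflection_mul_apply_snd (i j : B) (f : B → ℝ) :
    (dualReflection M i * dualReflection M j) f j =
      -cartanCoeff (M i j) * f i + (cartanCoeff (M i j) ^ 2 - 1) * f j := by
  rw [dualReflection_mul_apply, M.diagonal, show cartanCoeff 1 = 2 by
    simp [cartanCoeff]]
  ring

theorem end_pow_succ_apply {X : Type*} (f : Function.End X) (n : ℕ) (x : X) :
    (f ^ (n + 1)) x = (f ^ n) (f x) := by rw [pow_succ]; rfl

theorem cartanCoeff_four_sq : cartanCoeff 4 ^ 2 = 2 := by norm_num [cartanCoeff]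

theorem cartanCoeff_six_sq : cartanCoeff 6 ^ 2 = 3 := by norm_num [cartanCoeff]

theorem sq_dualReflection_mul_apply {i j : B} (h : M i j = 4) (f : B → ℝ) :
    ((dualReflection M i * dualReflection M j) ^ 2) f i = -f i ∧
      ((dualReflection M i * dualReflection M j) ^ 2) f j = -f j := by
  have h2 := cartanCoeff_four_sq
  simp only [end_pow_succ_apply, pow_zero, Function.End.one_def, id,
    dualReflection_mul_apply_fst, dualReflection_mul_apply_snd, h]
  constructor <;> grind

theorem cube_dualReflection_mul_apply {i j : B} (h : M i j = 6) (f : B → ℝ) :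
    ((dualReflection M i * dualReflection M j) ^ 3) f i = -f i ∧
      ((dualReflection M i * dualReflection M j) ^ 3) f j = -f j := by
  have h2 := cartanCoeff_six_sq
  simp only [end_pow_succ_apply, pow_zero, Function.End.one_def, id,
    dualReflection_mul_apply_fst, dualReflection_mul_apply_snd, h]
  constructor <;> grind

theorem exists_pow_dualReflection_mul_apply (i j k : B) (n : ℕ) :
    ∃ a b : ℝ, ∀ f : B → ℝ,
      ((dualReflection M i * dualReflection M j) ^ n) f k = f k + a * f i + b * f j := by
  induction n with
  | zero => exact ⟨0, 0, fun f => by simp [Function.End.one_def]⟩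
  | succ n ih =>
    obtain ⟨a, b, h⟩ := ih
    set x := cartanCoeff (M i j)
    refine ⟨-cartanCoeff (M i k) - a - b * x,
      -cartanCoeff (M j k) + cartanCoeff (M i k) * x + a * x + b * (x ^ 2 - 1), fun f => ?_⟩
    rw [end_pow_succ_apply, h, dualReflection_mul_apply, dualReflection_mul_apply_fst,
      dualReflection_mul_apply_snd]
    ring

/-- If half of the relator acts by `-1` on the plane of `i` and `j`, then the contributions of its
two halves to any other coordinate cancel. -/
theorem pow_dualReflection_mul_apply_of_neg {i j : B} (n : ℕ) (h : M i j = n + n)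
    (hn : ∀ f : B → ℝ, ((dualReflection M i * dualReflection M j) ^ n) f i = -f i ∧
      ((dualReflection M i * dualReflection M j) ^ n) f j = -f j) (f : B → ℝ) (k : B) :
    ((dualReflection M i * dualReflection M j) ^ M i j) f k = f k := by
  obtain ⟨a, b, hab⟩ := exists_pow_dualReflection_mul_apply (M := M) i j k n
  rw [h, pow_add]
  change ((dualReflection M i * dualReflection M j) ^ n)
    (((dualReflection M i * dualReflection M j) ^ n) f) k = f k
  rw [hab, (hn f).1, (hn f).2, hab]
  ring

/-- The condition on a Coxeter matrix that all finite Weyl groups satisfy. -/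
abbrev _root_.CoxeterMatrix.IsCrystallographic (M : CoxeterMatrix B) : Prop :=
  ∀ i j : B, M i j ∈ ({1, 2, 3, 4, 6} : Set ℕ)

theorem isLiftable_dualReflection (hM : M.IsCrystallographic) :
    M.IsLiftable (dualReflection M) := by
  intro i j
  funext f k
  change _ = f k
  have hij := hM i j
  simp only [Set.mem_insert_iff, Set.mem_singleton_iff] at hij
  rcases hij with h | h | h | h | h
  · obtain rfl : i = j := by
      by_contra hne
      exact M.off_diagonal i j hne h
    rw [h, pow_one, dualReflection_mul_apply, M.diagonal]
    simp only [cartanCoeff, if_true]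
    ring
  · rw [h]
    simp only [end_pow_succ_apply, pow_zero, Function.End.one_def, id,
      dualReflection_mul_apply i j k, dualReflection_mul_apply_fst,
      dualReflection_mul_apply_snd, h, show cartanCoeff 2 = 0 by simp [cartanCoeff]]
    ring
  · rw [h]
    simp only [end_pow_succ_apply, pow_zero, Function.End.one_def, id,
      dualReflection_mul_apply i j k, dualReflection_mul_apply_fst,
      dualReflection_mul_apply_snd, h, show cartanCoeff 3 = -1 by simp [cartanCoeff]]
    ring
  · exact pow_dualReflection_mul_apply_of_neg 2 h (sq_dualReflection_mul_apply h) f k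
  · exact pow_dualReflection_mul_apply_of_neg 3 h (cube_dualReflection_mul_apply h) f k

/-- The product `s_i s_j` has order exactly `M i j`. -/
theorem simple_mul_simple_pow_ne_one (hM : M.IsCrystallographic)
    {i j : B} {n : ℕ} (hn : 0 < n) (hn' : n < M i j) :
    (cs.simple i * cs.simple j) ^ n ≠ 1 := by
  classical
  intro hpow
  have h1 : (dualReflection M i * dualReflection M j) ^ n = 1 := by
    rw [← cs.lift_apply_simple (isLiftable_dualReflection hM) i,
      ← cs.lift_apply_simple (isLiftable_dualReflection hM) j, ← map_mul, ← map_pow, hpow, map_one]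
  have hij : i ≠ j := by
    rintro rfl
    rw [M.diagonal] at hn'
    omega
  -- A linear form that separates the powers of `s_i s_j`.
  set f : B → ℝ := Pi.single i 1
  have hi : f i = 1 := Pi.single_eq_same i 1
  have hj : f j = 0 := Pi.single_eq_of_ne' hij 1
  have hfi := congrFun (congrFun h1 f) i
  have hfj := congrFun (congrFun h1 f) j
  have e2 : cartanCoeff 2 = 0 := by simp [cartanCoeff]
  have e3 : cartanCoeff 3 = -1 := by simp [cartanCoeff]
  have e4 := cartanCoeff_four_sq
  have e6 := cartanCoeff_six_sq
  have hm := hM i j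
  simp only [Set.mem_insert_iff, Set.mem_singleton_iff] at hm
  rcases hm with h | h | h | h | h <;> rw [h] at hn' <;> interval_cases n <;>
    simp only [end_pow_succ_apply, pow_zero, Function.End.one_def, id,
      dualReflection_mul_apply_fst, dualReflection_mul_apply_snd, h, hi, hj] at hfi hfj <;>
    grind

/-! ### Matsumoto's theorem -/

theorem length_wordProd_alternatingWord (hM : M.IsCrystallographic)
    (i j : B) {q : ℕ} (hq : q ≤ M i j) : cs.length (cs.wordProd (alternatingWord i j q)) = q := by
  classical
  induction q generalizing i j with
  | zero => simp [alternatingWord]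
  | succ q ih =>
    rw [M.symmetric] at hq
    rw [alternatingWord_succ, wordProd_concat]
    refine (cs.not_isRightDescent_iff.mp fun h => ?_).trans (by rw [ih j i (by omega)])
    rw [isRightDescent_iff_invParity, invParity_alternatingWord,
      Finset.sum_eq_zero fun n hn => if_neg fun h' => ?_] at h
    · exact zero_ne_one h
    · refine cs.simple_mul_simple_pow_ne_one hM (i := j) (j := i) n.succ_pos
        (by rw [Finset.mem_range] at hn; omega) ?_
      rw [pow_succ', mul_assoc, ← h', simple_mul_simple_self]

theorem exists_eraseIdx_of_isRightDescent_append {ω₁ ω₂ : List B} {i : B}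
    (h : cs.IsRightDescent (cs.wordProd (ω₁ ++ ω₂)) i) :
    (∃ k < ω₁.length, cs.wordProd (ω₁ ++ ω₂) * cs.simple i = cs.wordProd (ω₁.eraseIdx k ++ ω₂)) ∨
      ∃ k < ω₂.length, cs.wordProd ω₂ * cs.simple i = cs.wordProd (ω₂.eraseIdx k) := by
  obtain ⟨k, hk, h⟩ := cs.exists_eraseIdx_of_isRightDescent h
  by_cases hk₁ : k < ω₁.length
  · rw [eraseIdx_append_of_lt_length hk₁] at h
    exact .inl ⟨k, hk₁, h⟩
  · rw [length_append] at hk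
    rw [eraseIdx_append_of_length_le (by omega), wordProd_append, wordProd_append, mul_assoc,
      mul_right_inj] at h
    exact .inr ⟨k - ω₁.length, by omega, h⟩

/-- An element with right descents `i` and `j` has a reduced word that ends in an alternating word
in `i` and `j`, of any length up to `M i j`. -/
theorem exists_reduced_append_alternatingWord
    (hM : M.IsCrystallographic) {w : W} {i j : B}
    (hi : cs.IsRightDescent w i) (hj : cs.IsRightDescent w j) {q : ℕ} (hq : q ≤ M i j) :
    ∃ ω : List B, w = cs.wordProd (ω ++ alternatingWord i j q) ∧
      cs.length w = ω.length + q := by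
  induction q generalizing i j with
  | zero =>
    obtain ⟨ω, hω, rfl⟩ := cs.exists_isReduced w
    exact ⟨ω, by simp [alternatingWord], hω⟩
  | succ q ih =>
    obtain ⟨ω, rfl, hω⟩ := ih hj hi (by rw [M.symmetric]; omega)
    rcases cs.exists_eraseIdx_of_isRightDescent_append hj with ⟨k, hk, h⟩ | ⟨k, hk, h⟩
    · refine ⟨ω.eraseIdx k, ?_, ?_⟩
      · rw [alternatingWord_succ, concat_eq_append, ← append_assoc,
          wordProd_append _ _ [j], wordProd_singleton, ← h, simple_mul_simple_cancel_right]
      · have := length_eraseIdx_add_one hk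
        omega
    -- A letter of the alternating word cannot be erased, as its extension by `j` is reduced.
    · rw [← wordProd_concat, ← alternatingWord_succ] at h
      have h1 := cs.length_wordProd_alternatingWord hM i j hq
      have h2 := cs.length_wordProd_le ((alternatingWord j i q).eraseIdx k)
      have h3 := length_eraseIdx_add_one hk
      rw [← h, h1] at h2
      rw [length_alternatingWord] at h3
      omega

theorem IsReduced.of_concat {ω : List B} {i : B} (h : cs.IsReduced (ω.concat i)) :
    cs.IsReduced ω := by
  simpa using h.take ω.length

theorem IsReduced.isRightDescent_concat {ω : List B} {i : B} (h : cs.IsReduced (ω.concat i)) :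
    cs.IsRightDescent (cs.wordProd (ω.concat i)) i := by
  rw [IsRightDescent, wordProd_concat, simple_mul_simple_cancel_right, ← wordProd_concat,
    h.eq, h.of_concat.eq]
  simp

/-- Matsumoto's theorem: the value of a reduced word in a monoid in which the braid relations hold
depends only on the element of `W` that the word represents. -/
theorem prod_map_eq_of_isReduced (hM : M.IsCrystallographic)
    {G : Type*} [Monoid G] {f : B → G}
    (hf : ∀ i j : B, ((braidWord M i j).map f).prod = ((braidWord M j i).map f).prod)
    {ω ω' : List B} (hω : cs.IsReduced ω) (hω' : cs.IsReduced ω')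
    (h : cs.wordProd ω = cs.wordProd ω') : (ω.map f).prod = (ω'.map f).prod := by
  have hlen : ω.length = ω'.length := by rw [← hω.eq, ← hω'.eq, h]
  generalize hn : ω.length = n at hlen
  induction n generalizing ω ω' with
  | zero =>
    rw [List.length_eq_zero_iff.mp hn, List.length_eq_zero_iff.mp hlen.symm]
  | succ n ih =>
    have hlast : ∀ (a b : List B) (i : B), cs.IsReduced (a.concat i) → cs.IsReduced (b.concat i) →
        cs.wordProd (a.concat i) = cs.wordProd (b.concat i) → a.length = n → b.length = n →
        ((a.concat i).map f).prod = ((b.concat i).map f).prod := by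
      intro a b i ha hb hab hla hlb
      rw [wordProd_concat, wordProd_concat, mul_left_inj] at hab
      have := ih ha.of_concat hb.of_concat hab hla hlb.symm
      simp [this]
    rcases eq_nil_or_concat ω with rfl | ⟨a, i, rfl⟩
    · simp at hn
    rcases eq_nil_or_concat ω' with rfl | ⟨b, j, rfl⟩
    · simp at hlen
    rw [length_concat] at hn hlen
    have hi := hω.isRightDescent_concat
    have hj := hω'.isRightDescent_concat
    rw [← h] at hj
    obtain ⟨c, hc, hcl⟩ := cs.exists_reduced_append_alternatingWord hM hi hj le_rfl
    obtain ⟨m, hm⟩ : ∃ m, M i j = m + 1 := by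
      refine Nat.exists_eq_succ_of_ne_zero fun h0 => ?_
      have := hM i j
      simp [h0] at this
    have hc' : cs.wordProd (a.concat i) = cs.wordProd (c ++ braidWord M j i) := by
      rw [hc, wordProd_append, wordProd_append, ← wordProd_braidWord_eq]
    have e1 : c ++ alternatingWord i j (M i j) = (c ++ alternatingWord j i m).concat j := by
      rw [hm, alternatingWord_succ]; simp
    have e2 : c ++ braidWord M j i = (c ++ alternatingWord i j m).concat i := by
      rw [braidWord, M.symmetric, hm, alternatingWord_succ]; simp
    have hl : cs.length (cs.wordProd (a.concat i)) = n + 1 := by rw [hω.eq, length_concat, hn]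
    have hcm : c.length + m = n := by omega
    rw [e1] at hc
    rw [e2] at hc'
    have r1 : ((a.concat i).map f).prod = ((c ++ braidWord M j i).map f).prod := by
      rw [e2]
      refine hlast _ _ _ hω ?_ hc' (by omega) (by simpa using hcm)
      rw [IsReduced, ← hc', hl]
      simp [← hcm, add_assoc]
    have r2 : ((b.concat j).map f).prod = ((c ++ braidWord M i j).map f).prod := by
      rw [braidWord, e1]
      refine hlast _ _ _ hω' ?_ (h.symm.trans hc) (by omega) (by simpa using hcm)
      rw [IsReduced, ← hc, hl]
      simp [← hcm, add_assoc]
    rw [r1, r2, map_append, map_append, prod_append, prod_append, hf]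

end CoxeterSystem

namespace KazhdanLusztig

open Polynomial LaurentPolynomial CoxeterSystem

variable {B W : Type*} [Group W] {M : CoxeterMatrix B} (cs : CoxeterSystem M W)

/-! ### The regular representation of the Hecke algebra -/

open Classical in
/-- The operator on the free module on `W` that left multiplication by `H_s` has to be. -/
noncomputable def leftOp (i : B) : Module.End LaurentRing (W →₀ LaurentRing) :=
  Finsupp.linearCombination LaurentRing fun w =>
    Finsupp.single (cs.simple i * w) 1 +
      if cs.IsLeftDescent w i then Finsupp.single w (vInv - v) else 0

open Classical in
/-- The operator on the free module on `W` that right multiplication by `H_s` has to be. -/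
noncomputable def rightOp (i : B) : Module.End LaurentRing (W →₀ LaurentRing) :=
  Finsupp.linearCombination LaurentRing fun w =>
    Finsupp.single (w * cs.simple i) 1 +
      if cs.IsRightDescent w i then Finsupp.single w (vInv - v) else 0

theorem end_ext {W : Type*} {f g : Module.End LaurentRing (W →₀ LaurentRing)}
    (h : ∀ w, f (Finsupp.single w 1) = g (Finsupp.single w 1)) : f = g :=
  Finsupp.lhom_ext' fun w => LinearMap.ext_ring (h w)

theorem single_eq_smul_one {W : Type*} (w : W) (a : LaurentRing) :
    Finsupp.single w a = a • Finsupp.single w (1 : LaurentRing) := by simp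

open Classical in
theorem leftOp_single (i : B) (w : W) :
    leftOp cs i (Finsupp.single w 1) = Finsupp.single (cs.simple i * w) 1 +
      if cs.IsLeftDescent w i then (vInv - v) • Finsupp.single w 1 else 0 := by
  rw [leftOp, Finsupp.linearCombination_single, one_smul, ← single_eq_smul_one]

open Classical in
theorem rightOp_single (i : B) (w : W) :
    rightOp cs i (Finsupp.single w 1) = Finsupp.single (w * cs.simple i) 1 +
      if cs.IsRightDescent w i then (vInv - v) • Finsupp.single w 1 else 0 := by
  rw [rightOp, Finsupp.linearCombination_single, one_smul, ← single_eq_smul_one]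

theorem leftOp_single_of_not_isLeftDescent {i : B} {w : W} (h : ¬ cs.IsLeftDescent w i) :
    leftOp cs i (Finsupp.single w 1) = Finsupp.single (cs.simple i * w) 1 := by
  classical rw [leftOp_single, if_neg h, add_zero]

theorem rightOp_single_of_not_isRightDescent {i : B} {w : W} (h : ¬ cs.IsRightDescent w i) :
    rightOp cs i (Finsupp.single w 1) = Finsupp.single (w * cs.simple i) 1 := by
  classical rw [rightOp_single, if_neg h, add_zero]

/-- The exchange condition enters here: away from the case `s w = w t`, multiplication by `t` does
not affect whether `s` is a left descent, and conversely. -/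
theorem leftOp_mul_rightOp (i j : B) : leftOp cs i * rightOp cs j = rightOp cs j * leftOp cs i := by
  classical
  refine end_ext fun w => ?_
  rw [Module.End.mul_apply, Module.End.mul_apply, leftOp_single, rightOp_single]
  have e : ∀ (p : Prop) [Decidable p] (f : Module.End LaurentRing (W →₀ LaurentRing)) x,
      f (if p then (vInv - v) • x else 0) = if p then (vInv - v) • f x else 0 := by
    intro p _ f x
    split_ifs <;> simp
  rw [map_add, map_add, e, e, leftOp_single, rightOp_single, leftOp_single, rightOp_single,
    mul_assoc]
  by_cases h : cs.simple i * w = w * cs.simple j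
  · have h1 := cs.isLeftDescent_iff_isRightDescent_of_eq h
    have h2 : cs.IsLeftDescent (w * cs.simple j) i ↔ ¬ cs.IsLeftDescent w i := by
      rw [← h, cs.isLeftDescent_iff_not_isLeftDescent_mul (w := w), not_not]
    have h3 : cs.IsRightDescent (w * cs.simple j) j ↔ ¬ cs.IsRightDescent w j := by
      rw [cs.isRightDescent_iff_not_isRightDescent_mul (w := w), not_not]
    simp only [h2, h3, h1, h]
  · simp only [cs.isLeftDescent_mul_simple_iff h, cs.isRightDescent_simple_mul_iff h]
    split_ifs <;> simp only [smul_add, add_zero]; abel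

theorem leftOp_mul_self (i : B) :
    leftOp cs i * leftOp cs i = 1 + (vInv - v) • leftOp cs i := by
  classical
  refine end_ext fun w => ?_
  rw [Module.End.mul_apply, LinearMap.add_apply, LinearMap.smul_apply, Module.End.one_apply]
  by_cases h : cs.IsLeftDescent w i
  · have h' := cs.isLeftDescent_iff_not_isLeftDescent_mul.mp h
    rw [leftOp_single, if_pos h, map_add, map_smul, leftOp_single_of_not_isLeftDescent cs h',
      simple_mul_simple_cancel_left, leftOp_single, if_pos h]
  · have h' : cs.IsLeftDescent (cs.simple i * w) i := by
      rwa [cs.isLeftDescent_iff_not_isLeftDescent_mul, simple_mul_simple_cancel_left]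
    rw [leftOp_single_of_not_isLeftDescent cs h, leftOp_single, if_pos h',
      simple_mul_simple_cancel_left]

theorem prod_leftOp_single_one {ω : List B} (h : cs.IsReduced ω) :
    (ω.map (leftOp cs)).prod (Finsupp.single 1 1) = Finsupp.single (cs.wordProd ω) 1 := by
  induction ω with
  | nil => simp
  | cons i ω ih =>
    have h' : cs.IsReduced ω := by simpa using h.drop 1
    rw [List.map_cons, List.prod_cons, Module.End.mul_apply, ih h',
      leftOp_single_of_not_isLeftDescent, wordProd_cons]
    rw [not_isLeftDescent_iff, ← wordProd_cons, h.eq, h'.eq, List.length_cons]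

theorem commute_prod_leftOp_rightOp (ω : List B) (j : B) :
    Commute (ω.map (leftOp cs)).prod (rightOp cs j) := by
  refine Commute.list_prod_left _ _ fun f hf => ?_
  obtain ⟨i, -, rfl⟩ := List.mem_map.mp hf
  exact leftOp_mul_rightOp cs i j

/-- Operators that commute with all right multiplications are determined by their value at the
identity, since right multiplications generate everything from there. -/
theorem eq_of_commute_rightOp {f g : Module.End LaurentRing (W →₀ LaurentRing)}
    (hf : ∀ j, Commute f (rightOp cs j)) (hg : ∀ j, Commute g (rightOp cs j))
    (h : f (Finsupp.single 1 1) = g (Finsupp.single 1 1)) : f = g := by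
  refine end_ext fun w => ?_
  generalize hn : cs.length w = n
  induction n generalizing w with
  | zero => rwa [cs.length_eq_zero_iff.mp hn]
  | succ n ih =>
    obtain ⟨j, hj⟩ := cs.exists_rightDescent_of_ne_one (w := w) (by rintro rfl; simp at hn)
    have e : Finsupp.single w 1 = rightOp cs j (Finsupp.single (w * cs.simple j) 1) := by
      rw [rightOp_single_of_not_isRightDescent cs
        (cs.isRightDescent_iff_not_isRightDescent_mul.mp hj), simple_mul_simple_cancel_right]
    have ih' := ih (w * cs.simple j) (by rw [isRightDescent_iff] at hj; omega)
    rw [e, ← Module.End.mul_apply, ← Module.End.mul_apply, (hf j).eq, (hg j).eq,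
      Module.End.mul_apply, Module.End.mul_apply, ih']

theorem prod_leftOp_braid (hM : M.IsCrystallographic) (i j : B) :
    ((braidWord M i j).map (leftOp cs)).prod = ((braidWord M j i).map (leftOp cs)).prod := by
  have h : ∀ i j : B, cs.IsReduced (braidWord M i j) := fun i j => by
    rw [CoxeterSystem.IsReduced, cs.length_wordProd_alternatingWord hM i j le_rfl,
      length_alternatingWord]
  refine eq_of_commute_rightOp cs (commute_prod_leftOp_rightOp cs _)
    (commute_prod_leftOp_rightOp cs _) ?_
  rw [prod_leftOp_single_one cs (h i j), prod_leftOp_single_one cs (h j i), wordProd_braidWord_eq]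

theorem lift_leftOp_rel (hM : M.IsCrystallographic)
    ⦃x y : FreeAlgebra LaurentRing B⦄ (h : HeckeRel M x y) :
    FreeAlgebra.lift LaurentRing (leftOp cs) x = FreeAlgebra.lift LaurentRing (leftOp cs) y := by
  have e : ∀ l : List B, FreeAlgebra.lift LaurentRing (leftOp cs)
      (l.map (FreeAlgebra.ι LaurentRing)).prod = (l.map (leftOp cs)).prod := fun l => by
    rw [map_list_prod, List.map_map]
    congr 2
    funext i
    exact FreeAlgebra.lift_ι_apply _ _
  induction h with
  | braid i j => rw [e, e, prod_leftOp_braid cs hM]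
  | quadratic i =>
    rw [map_mul, map_add, map_one, map_smul, FreeAlgebra.lift_ι_apply, leftOp_mul_self]

/-- The action of the Hecke algebra on the free module on `W`. -/
noncomputable def regularRep (hM : M.IsCrystallographic) :
    HeckeAlgebra M →ₐ[LaurentRing] Module.End LaurentRing (W →₀ LaurentRing) :=
  RingQuot.liftAlgHom LaurentRing
    ⟨FreeAlgebra.lift LaurentRing (leftOp cs), lift_leftOp_rel cs hM⟩

theorem regularRep_heckeGen (hM : M.IsCrystallographic) (i : B) :
    regularRep cs hM (heckeGen M i) = leftOp cs i := by
  have h := RingQuot.liftAlgHom_mkAlgHom_apply LaurentRing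
    (FreeAlgebra.lift LaurentRing (leftOp cs)) (lift_leftOp_rel cs hM)
    (FreeAlgebra.ι LaurentRing i)
  rw [FreeAlgebra.lift_ι_apply] at h
  exact h

/-- The coordinates of an element of the Hecke algebra in the standard basis. -/
noncomputable def stdCoord (hM : M.IsCrystallographic) :
    HeckeAlgebra M →ₗ[LaurentRing] (W →₀ LaurentRing) :=
  (LinearMap.applyₗ (Finsupp.single 1 1)).comp (regularRep cs hM).toLinearMap

theorem stdCoord_stdBasis (hM : M.IsCrystallographic) (w : W) :
    stdCoord cs hM (stdBasis cs w) = Finsupp.single w 1 := by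
  obtain ⟨h1, h2⟩ := (cs.exists_isReduced w).choose_spec
  change regularRep cs hM (stdBasis cs w) (Finsupp.single 1 1) = _
  rw [stdBasis, map_list_prod, List.map_map]
  conv_rhs => rw [h2]
  rw [← prod_leftOp_single_one cs h1]
  congr 3
  funext i
  exact regularRep_heckeGen cs hM i

/-! ### Multiplication in the standard basis -/

theorem prod_heckeGen_eq_stdBasis (hM : M.IsCrystallographic)
    {ω : List B} (h : cs.IsReduced ω) :
    (ω.map (heckeGen M)).prod = stdBasis cs (cs.wordProd ω) := by
  obtain ⟨h1, h2⟩ := (cs.exists_isReduced (cs.wordProd ω)).choose_spec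
  exact cs.prod_map_eq_of_isReduced hM (heckeGen_braid M) h h1 h2

theorem stdBasis_one (hM : M.IsCrystallographic) :
    stdBasis cs (1 : W) = 1 := by
  have h := prod_heckeGen_eq_stdBasis cs hM (ω := []) (by simp [CoxeterSystem.IsReduced])
  simpa using h.symm

theorem stdBasis_mul_of_length (hM : M.IsCrystallographic) {x y : W}
    (h : cs.length (x * y) = cs.length x + cs.length y) :
    stdBasis cs x * stdBasis cs y = stdBasis cs (x * y) := by
  obtain ⟨a, ha, rfl⟩ := cs.exists_isReduced x
  obtain ⟨b, hb, rfl⟩ := cs.exists_isReduced y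
  rw [← wordProd_append, ← prod_heckeGen_eq_stdBasis cs hM ha, ← prod_heckeGen_eq_stdBasis cs hM hb,
    ← prod_heckeGen_eq_stdBasis cs hM, List.map_append, List.prod_append]
  rw [CoxeterSystem.IsReduced, wordProd_append, h, ha.eq, hb.eq, List.length_append]

theorem stdBasis_simple (hM : M.IsCrystallographic) (i : B) :
    stdBasis cs (cs.simple i) = heckeGen M i := by
  have h := prod_heckeGen_eq_stdBasis cs hM (ω := [i]) (by simp [CoxeterSystem.IsReduced])
  simpa using h.symm

theorem heckeGen_mul_stdBasis_of_not (hM : M.IsCrystallographic) {i : B}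
    {w : W} (h : ¬ cs.IsLeftDescent w i) :
    heckeGen M i * stdBasis cs w = stdBasis cs (cs.simple i * w) := by
  rw [← stdBasis_simple cs hM, stdBasis_mul_of_length cs hM]
  rw [cs.not_isLeftDescent_iff.mp h, length_simple, add_comm]

theorem heckeGen_mul_stdBasis_of_isLeftDescent
    (hM : M.IsCrystallographic) {i : B}
    {w : W} (h : cs.IsLeftDescent w i) :
    heckeGen M i * stdBasis cs w =
      stdBasis cs (cs.simple i * w) + (vInv - v) • stdBasis cs w := by
  have e : stdBasis cs w = heckeGen M i * stdBasis cs (cs.simple i * w) := by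
    rw [heckeGen_mul_stdBasis_of_not cs hM (cs.isLeftDescent_iff_not_isLeftDescent_mul.mp h),
      simple_mul_simple_cancel_left]
  conv_lhs => rw [e]
  rw [← mul_assoc, heckeGen_mul_self, add_mul, one_mul, smul_mul_assoc, ← e]

/-! ### The length filtration -/

/-- The span of all `H_y` with `ℓ(y) < n`. -/
noncomputable def lengthFiltration (n : ℕ) : Submodule LaurentRing (HeckeAlgebra M) :=
  Submodule.span LaurentRing (stdBasis cs '' {y : W | cs.length y < n})

theorem lengthFiltration_mono {m n : ℕ} (h : m ≤ n) :
    lengthFiltration cs m ≤ lengthFiltration cs n :=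
  Submodule.span_mono (Set.image_mono fun _ hy => lt_of_lt_of_le hy h)

theorem stdBasis_mem_lengthFiltration {y : W} {n : ℕ} (h : cs.length y < n) :
    stdBasis cs y ∈ lengthFiltration cs n :=
  Submodule.subset_span ⟨y, h, rfl⟩

theorem heckeGen_mul_mem_lengthFiltration (hM : M.IsCrystallographic) (i : B) {n : ℕ}
    {x : HeckeAlgebra M} (hx : x ∈ lengthFiltration cs n) :
    heckeGen M i * x ∈ lengthFiltration cs (n + 1) := by
  induction hx using Submodule.span_induction with
  | mem x hx =>
    obtain ⟨y, hy, rfl⟩ := hx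
    rw [Set.mem_ofPred_eq] at hy
    by_cases h : cs.IsLeftDescent y i
    · rw [heckeGen_mul_stdBasis_of_isLeftDescent cs hM h]
      rw [isLeftDescent_iff] at h
      exact add_mem (stdBasis_mem_lengthFiltration cs (by omega))
        (Submodule.smul_mem _ _ (stdBasis_mem_lengthFiltration cs (by omega)))
    · rw [heckeGen_mul_stdBasis_of_not cs hM h]
      rw [not_isLeftDescent_iff] at h
      exact stdBasis_mem_lengthFiltration cs (by omega)
  | zero => simp
  | add x y _ _ hx hy => rw [mul_add]; exact add_mem hx hy
  | smul a x _ hx => rw [mul_smul_comm]; exact Submodule.smul_mem _ _ hx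

theorem stdBasis_mul_mem_lengthFiltration (hM : M.IsCrystallographic) (w : W) {n : ℕ}
    {x : HeckeAlgebra M} (hx : x ∈ lengthFiltration cs n) :
    stdBasis cs w * x ∈ lengthFiltration cs (cs.length w + n) := by
  obtain ⟨ω, hω, rfl⟩ := cs.exists_isReduced w
  rw [hω.eq, ← prod_heckeGen_eq_stdBasis cs hM hω]
  clear hω
  induction ω with
  | nil => simpa using hx
  | cons i ω ih =>
    rw [List.map_cons, List.prod_cons, mul_assoc, List.length_cons, add_right_comm]
    exact heckeGen_mul_mem_lengthFiltration cs hM i ih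

theorem mul_mem_lengthFiltration (hM : M.IsCrystallographic) {m n : ℕ}
    {x y : HeckeAlgebra M} (hx : x ∈ lengthFiltration cs m) (hy : y ∈ lengthFiltration cs (n + 1)) :
    x * y ∈ lengthFiltration cs (m + n) := by
  induction hx using Submodule.span_induction with
  | mem x hx =>
    obtain ⟨w, hw, rfl⟩ := hx
    rw [Set.mem_ofPred_eq] at hw
    exact lengthFiltration_mono cs (by omega) (stdBasis_mul_mem_lengthFiltration cs hM w hy)
  | zero => simp
  | add x x' _ _ hx hx' => rw [add_mul]; exact add_mem hx hx'
  | smul a x _ hx => rw [smul_mul_assoc]; exact Submodule.smul_mem _ _ hx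

theorem stdCoord_eq_zero_of_mem_lengthFiltration (hM : M.IsCrystallographic) {n : ℕ}
    {x : HeckeAlgebra M} (hx : x ∈ lengthFiltration cs n) {y : W} (hy : n ≤ cs.length y) :
    stdCoord cs hM x y = 0 := by
  induction hx using Submodule.span_induction with
  | mem x hx =>
    obtain ⟨z, hz, rfl⟩ := hx
    rw [Set.mem_ofPred_eq] at hz
    rw [stdCoord_stdBasis, Finsupp.single_eq_of_ne']
    rintro rfl
    omega
  | zero => simp
  | add x x' _ _ hx hx' => rw [map_add, Finsupp.add_apply, hx, hx', add_zero]
  | smul a x _ hx => rw [map_smul, Finsupp.smul_apply, hx, smul_zero]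

theorem span_range_stdBasis (hM : M.IsCrystallographic) :
    Submodule.span LaurentRing (Set.range (stdBasis cs)) = ⊤ := by
  set P := Submodule.span LaurentRing (Set.range (stdBasis cs))
  have hle : ∀ n, lengthFiltration cs n ≤ P := fun n =>
    Submodule.span_mono (Set.image_subset_range _ _)
  have hgen : ∀ i, ∀ x ∈ P, heckeGen M i * x ∈ P := by
    intro i x hx
    induction hx using Submodule.span_induction with
    | mem x hx =>
      obtain ⟨y, rfl⟩ := hx
      exact hle _ (heckeGen_mul_mem_lengthFiltration cs hM i
        (stdBasis_mem_lengthFiltration cs (Nat.lt_succ_self _)))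
    | zero => simp
    | add x y _ _ hx hy => rw [mul_add]; exact add_mem hx hy
    | smul a x _ hx => rw [mul_smul_comm]; exact Submodule.smul_mem _ _ hx
  have hmul : ∀ f : FreeAlgebra LaurentRing B, ∀ x ∈ P, heckeMk M f * x ∈ P := by
    intro f
    induction f using FreeAlgebra.induction with
    | grade0 a =>
      intro x hx
      rw [AlgHom.commutes, ← Algebra.smul_def]
      exact Submodule.smul_mem _ _ hx
    | grade1 i => exact hgen i
    | mul f g hf hg =>
      intro x hx
      rw [map_mul, mul_assoc]
      exact hf _ (hg _ hx)
    | add f g hf hg =>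
      intro x hx
      rw [map_add, add_mul]
      exact add_mem (hf _ hx) (hg _ hx)
  refine eq_top_iff.mpr fun x _ => ?_
  obtain ⟨f, rfl⟩ := RingQuot.mkAlgHom_surjective LaurentRing (HeckeRel M) x
  have h1 : (1 : HeckeAlgebra M) ∈ P := by
    rw [← stdBasis_one cs hM]
    exact Submodule.subset_span ⟨1, rfl⟩
  have := hmul f 1 h1
  rwa [mul_one] at this

/-! ### The bar involution in the standard basis -/

variable (M) in
theorem bar_smul (a : LaurentRing) (x : HeckeAlgebra M) :
    bar M (a • x) = LaurentPolynomial.invert a • bar M x := by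
  rw [Algebra.smul_def, map_mul, bar_algebraMap, ← Algebra.smul_def]

variable (M) in
theorem bar_heckeGen_eq (i : B) : bar M (heckeGen M i) = heckeGen M i - (vInv - v) • 1 :=
  bar_heckeGen M i

theorem bar_stdBasis_sub_mem (hM : M.IsCrystallographic) (w : W) :
    bar M (stdBasis cs w) - stdBasis cs w ∈ lengthFiltration cs (cs.length w) := by
  generalize hn : cs.length w = n
  induction n generalizing w with
  | zero =>
    rw [cs.length_eq_zero_iff.mp hn, stdBasis_one cs hM, map_one, sub_self]
    exact zero_mem _
  | succ n ih =>
    obtain ⟨i, hi⟩ := cs.exists_leftDescent_of_ne_one (w := w) (by rintro rfl; simp at hn)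
    have e : stdBasis cs w = heckeGen M i * stdBasis cs (cs.simple i * w) := by
      rw [heckeGen_mul_stdBasis_of_not cs hM (cs.isLeftDescent_iff_not_isLeftDescent_mul.mp hi),
        simple_mul_simple_cancel_left]
    rw [isLeftDescent_iff] at hi
    have hu := ih (cs.simple i * w) (by omega)
    have hu' : stdBasis cs (cs.simple i * w) ∈ lengthFiltration cs (n + 1) :=
      stdBasis_mem_lengthFiltration cs (by omega)
    set x := stdBasis cs (cs.simple i * w)
    have e2 : bar M (stdBasis cs w) - stdBasis cs w =
        heckeGen M i * (bar M x - x) - (vInv - v) • (bar M x - x) - (vInv - v) • x := by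
      rw [e, map_mul, bar_heckeGen_eq, sub_mul, smul_mul_assoc, one_mul, mul_sub, smul_sub]
      abel
    rw [e2]
    exact sub_mem (sub_mem (heckeGen_mul_mem_lengthFiltration cs hM i hu)
      (Submodule.smul_mem _ _ (lengthFiltration_mono cs n.le_succ hu))) (Submodule.smul_mem _ _ hu')

theorem eq_zero_of_invert_eq {p : ℤ[X]}
    (h : LaurentPolynomial.invert (toLaurent (X * p)) = (toLaurent (X * p) : LaurentRing)) :
    p = 0 := by
  ext n
  have h1 := congrArg (fun f => f.coeff ((n + 1 : ℕ) : ℤ)) h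
  simp only [LaurentPolynomial.invert_apply, LaurentPolynomial.coeff_toLaurent] at h1
  have e : ((n + 1 : ℕ) : ℤ) = Nat.castEmbedding (R := ℤ) (n + 1) := rfl
  rw [Finsupp.mapDomain_of_notMem_range, e, Finsupp.mapDomain_apply Nat.castEmbedding.injective]
    at h1
  · change 0 = (X * p).coeff (n + 1) at h1
    rw [coeff_X_mul] at h1
    exact h1.symm
  · rintro ⟨m, hm⟩
    rw [Nat.castEmbedding_apply] at hm
    omega

theorem stdCoord_sum_apply (hM : M.IsCrystallographic) (q : W →₀ ℤ[X]) (y : W) :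
    stdCoord cs hM (q.sum fun z p => (toLaurent (X * p) : LaurentRing) • stdBasis cs z) y =
      toLaurent (X * q y) := by
  classical
  rw [Finsupp.sum, map_sum, Finsupp.finsetSum_apply]
  simp only [map_smul, stdCoord_stdBasis, Finsupp.smul_apply, Finsupp.single_apply, smul_eq_mul,
    mul_ite, mul_one, mul_zero, Finset.sum_ite_eq', Finsupp.mem_support_iff]
  split_ifs with h
  · rfl
  · rw [not_not.mp h, mul_zero, map_zero]

/-- The only element of `∑ v ℤ[v] H_y` that is invariant under the bar involution is `0`. -/
theorem eq_zero_of_bar_eq (hM : M.IsCrystallographic) {q : W →₀ ℤ[X]}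
    (h : bar M (q.sum fun y p => (toLaurent (X * p) : LaurentRing) • stdBasis cs y) =
      q.sum fun y p => (toLaurent (X * p) : LaurentRing) • stdBasis cs y) : q = 0 := by
  classical
  by_contra hq
  obtain ⟨y, hy, hmax⟩ := Finset.exists_max_image q.support cs.length
    (Finsupp.support_nonempty_iff.mpr hq)
  apply Finsupp.mem_support_iff.mp hy
  apply eq_zero_of_invert_eq
  -- As `y` has maximal length, only its own summand contributes to the coordinate at `y`.
  have h1 := congrArg (fun x => stdCoord cs hM x y) h
  simp only [stdCoord_sum_apply] at h1
  refine Eq.trans (Eq.symm ?_) h1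
  rw [Finsupp.sum, map_sum, map_sum, Finsupp.finsetSum_apply, Finset.sum_eq_single y]
  · have h2 := stdCoord_eq_zero_of_mem_lengthFiltration cs hM (bar_stdBasis_sub_mem cs hM y) le_rfl
    rw [map_sub, Finsupp.sub_apply, stdCoord_stdBasis, Finsupp.single_eq_same, sub_eq_zero] at h2
    rw [bar_smul, map_smul, Finsupp.smul_apply, h2, smul_eq_mul, mul_one]
  · intro z hz hzy
    have h2 := stdCoord_eq_zero_of_mem_lengthFiltration cs hM (bar_stdBasis_sub_mem cs hM z)
      (hmax z hz)
    rw [map_sub, Finsupp.sub_apply, stdCoord_stdBasis, Finsupp.single_eq_of_ne' hzy, sub_zero] at h2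
    rw [bar_smul, map_smul, Finsupp.smul_apply, h2, smul_zero]
  · exact fun h' => absurd hy h'

theorem IsKLElement.unique (hM : M.IsCrystallographic) {w : W} {C C' : HeckeAlgebra M}
    (h : IsKLElement cs w C) (h' : IsKLElement cs w C') : C = C' := by
  obtain ⟨hb, q, hq⟩ := h
  obtain ⟨hb', q', hq'⟩ := h'
  have e : (q - q').sum (fun y p => (toLaurent (X * p) : LaurentRing) • stdBasis cs y) =
      C - C' := by
    rw [Finsupp.sum_sub_index fun a b c => by rw [mul_sub, map_sub, sub_smul], hq, hq']
    abel
  have h0 : q - q' = 0 := eq_zero_of_bar_eq cs hM (by rw [e, map_sub, hb, hb'])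
  rw [hq, hq', sub_eq_zero.mp h0]

/-! ### Existence of the Kazhdan-Lusztig basis -/

/-- The `ℤ[v]`-lattice spanned by all `H_y` with `ℓ(y) < n`. The ring `ℤ[v]` is realized as a
subring of `ℤ[v, v⁻¹]`, so that its action on the Hecke algebra is the restricted one. -/
noncomputable def lengthLattice (n : ℕ) :
    Submodule (toLaurent (R := ℤ)).range (HeckeAlgebra M) :=
  Submodule.span _ (stdBasis cs '' {y : W | cs.length y < n})

theorem lengthLattice_mono {m n : ℕ} (h : m ≤ n) : lengthLattice cs m ≤ lengthLattice cs n :=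
  Submodule.span_mono (Set.image_mono fun _ hy => lt_of_lt_of_le hy h)

theorem stdBasis_mem_lengthLattice {y : W} {n : ℕ} (h : cs.length y < n) :
    stdBasis cs y ∈ lengthLattice cs n :=
  Submodule.subset_span ⟨y, h, rfl⟩

theorem toLaurent_smul_mem_lengthLattice (p : ℤ[X]) {n : ℕ} {x : HeckeAlgebra M}
    (hx : x ∈ lengthLattice cs n) : (toLaurent p : LaurentRing) • x ∈ lengthLattice cs n :=
  Submodule.smul_mem (lengthLattice cs n) (⟨toLaurent p, p, rfl⟩ : (toLaurent (R := ℤ)).range) hx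

theorem v_smul_mem_lengthLattice {n : ℕ} {x : HeckeAlgebra M} (hx : x ∈ lengthLattice cs n) :
    v • x ∈ lengthLattice cs n := by
  have := toLaurent_smul_mem_lengthLattice cs X hx
  rwa [toLaurent_X] at this

theorem lengthLattice_le {n : ℕ} {x : HeckeAlgebra M} (hx : x ∈ lengthLattice cs n) :
    x ∈ lengthFiltration cs n := by
  induction hx using Submodule.span_induction with
  | mem x hx => exact Submodule.subset_span hx
  | zero => exact zero_mem _
  | add x y _ _ hx hy => exact add_mem hx hy
  | smul a x _ hx => exact Submodule.smul_mem _ (a : LaurentRing) hx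

theorem exists_finsupp_of_mem_lengthLattice {n : ℕ} {x : HeckeAlgebra M}
    (hx : x ∈ lengthLattice cs n) : ∃ q : W →₀ ℤ[X],
      v • x = q.sum fun y p => (toLaurent (X * p) : LaurentRing) • stdBasis cs y := by
  induction hx using Submodule.span_induction with
  | mem x hx =>
    obtain ⟨y, -, rfl⟩ := hx
    refine ⟨Finsupp.single y 1, ?_⟩
    rw [Finsupp.sum_single_index (by simp), mul_one, toLaurent_X]
  | zero => exact ⟨0, by simp⟩
  | add x y _ _ hx hy =>
    obtain ⟨q, hq⟩ := hx
    obtain ⟨r, hr⟩ := hy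
    refine ⟨q + r, ?_⟩
    rw [smul_add, hq, hr, Finsupp.sum_add_index' (by simp)]
    intro a b c
    rw [mul_add, map_add, add_smul]
  | smul a x _ hx =>
    obtain ⟨_, p, rfl⟩ := a
    obtain ⟨q, hq⟩ := hx
    refine ⟨p • q, ?_⟩
    change v • ((toLaurent p : LaurentRing) • x) = _
    rw [smul_comm, hq, Finsupp.sum_smul_index' (by simp), Finsupp.smul_sum]
    refine Finsupp.sum_congr fun y _ => ?_
    rw [smul_smul, ← map_mul, smul_eq_mul, mul_left_comm]

theorem klGen_mul_smul_mem_lengthLattice (hM : M.IsCrystallographic) (i : B) {n : ℕ}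
    {x : HeckeAlgebra M} (hx : x ∈ lengthLattice cs n) :
    (heckeGen M i + v • 1) * (v • x) ∈ lengthLattice cs (n + 1) := by
  induction hx using Submodule.span_induction with
  | mem x hx =>
    obtain ⟨y, hy, rfl⟩ := hx
    rw [Set.mem_ofPred_eq] at hy
    rw [mul_smul_comm, add_mul, smul_mul_assoc, one_mul]
    have hy' : stdBasis cs y ∈ lengthLattice cs (n + 1) :=
      stdBasis_mem_lengthLattice cs (by omega)
    by_cases h : cs.IsLeftDescent y i
    · rw [heckeGen_mul_stdBasis_of_isLeftDescent cs hM h, add_assoc, ← add_smul,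
        sub_add_cancel, smul_add, smul_smul, ← T_add, add_neg_cancel, T_zero, one_smul]
      rw [isLeftDescent_iff] at h
      exact add_mem (v_smul_mem_lengthLattice cs (stdBasis_mem_lengthLattice cs (by omega))) hy'
    · rw [heckeGen_mul_stdBasis_of_not cs hM h]
      rw [not_isLeftDescent_iff] at h
      exact v_smul_mem_lengthLattice cs (add_mem (stdBasis_mem_lengthLattice cs (by omega))
        (v_smul_mem_lengthLattice cs hy'))
  | zero => simp
  | add x y _ _ hx hy => rw [smul_add, mul_add]; exact add_mem hx hy
  | smul a x _ hx =>
    obtain ⟨_, p, rfl⟩ := a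
    change _ * v • ((toLaurent p : LaurentRing) • x) ∈ _
    rw [smul_comm, mul_smul_comm]
    exact toLaurent_smul_mem_lengthLattice cs p hx

/-- An element `C ∈ H_w + ∑ v ℤ[v] H_y` invariant under the bar involution, where the sum is over
all `y` with `ℓ(y) < ℓ(w)`. -/
def IsTriangularKLElement (w : W) (C : HeckeAlgebra M) : Prop :=
  bar M C = C ∧ ∃ d ∈ lengthLattice cs (cs.length w), C = stdBasis cs w + v • d

/-- Modulo `v`, every element of the lattice is an integral combination of Kazhdan-Lusztig
elements, which are bar invariant. -/
theorem exists_bar_eq_of_mem_lengthLattice {n : ℕ}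
    (h : ∀ y : W, cs.length y < n → ∃ C, IsTriangularKLElement cs y C) {x : HeckeAlgebra M}
    (hx : x ∈ lengthLattice cs n) :
    ∃ c, bar M c = c ∧ ∃ d ∈ lengthLattice cs n, c = x + v • d := by
  induction hx using Submodule.span_induction with
  | mem x hx =>
    obtain ⟨y, hy, rfl⟩ := hx
    obtain ⟨C, hC, d, hd, hCd⟩ := h y hy
    exact ⟨C, hC, d, lengthLattice_mono cs (le_of_lt hy) hd, hCd⟩
  | zero => exact ⟨0, map_zero _, 0, zero_mem _, by simp⟩
  | add x y _ _ hx hy =>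
    obtain ⟨c, hc, d, hd, rfl⟩ := hx
    obtain ⟨c', hc', d', hd', rfl⟩ := hy
    refine ⟨x + v • d + (y + v • d'), by rw [map_add, hc, hc'], d + d', add_mem hd hd', ?_⟩
    rw [smul_add]
    abel
  | smul a x hxm hx =>
    obtain ⟨_, p, rfl⟩ := a
    obtain ⟨c, hc, d, hd, hcd⟩ := hx
    change ∃ c, bar M c = c ∧
      ∃ d ∈ lengthLattice cs n, c = (toLaurent p : LaurentRing) • x + v • d
    -- The constant term of `p` acts on `c`; the rest of `p` is divisible by `v`.
    refine ⟨p.coeff 0 • c, by rw [map_zsmul, hc],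
      p.coeff 0 • d - (toLaurent p.divX : LaurentRing) • x,
      sub_mem (zsmul_mem hd _) (toLaurent_smul_mem_lengthLattice cs _ hxm), ?_⟩
    have e : (toLaurent p : LaurentRing) = v * toLaurent p.divX + (p.coeff 0 : LaurentRing) := by
      conv_lhs => rw [← p.X_mul_divX_add]
      simp
    rw [hcd, e, add_smul, mul_smul, smul_sub, smul_add, Int.cast_smul_eq_zsmul,
      smul_comm v (p.coeff 0) d]
    abel

theorem exists_isTriangularKLElement (hM : M.IsCrystallographic) (w : W) :
    ∃ C, IsTriangularKLElement cs w C := by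
  generalize hn : cs.length w = n
  induction n using Nat.strong_induction_on generalizing w with
  | _ n ih =>
  by_cases hw : w = 1
  · subst hw
    exact ⟨1, map_one _, 0, zero_mem _, by rw [stdBasis_one cs hM, smul_zero, add_zero]⟩
  obtain ⟨i, hi⟩ := cs.exists_leftDescent_of_ne_one hw
  have hi' := cs.isLeftDescent_iff.mp hi
  obtain ⟨C, hC, d, hd, hCd⟩ := ih _ (by omega) (cs.simple i * w) rfl
  have e : (heckeGen M i + v • 1) * C = stdBasis cs w +
      (v • stdBasis cs (cs.simple i * w) + (heckeGen M i + v • 1) * (v • d)) := by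
    rw [hCd, mul_add, add_mul, heckeGen_mul_stdBasis_of_not cs hM
      (cs.isLeftDescent_iff_not_isLeftDescent_mul.mp hi), simple_mul_simple_cancel_left,
      smul_mul_assoc, one_mul, add_assoc]
  have hmem : v • stdBasis cs (cs.simple i * w) + (heckeGen M i + v • 1) * (v • d) ∈
      lengthLattice cs (cs.length w) := by
    rw [← hi']
    exact add_mem (v_smul_mem_lengthLattice cs (stdBasis_mem_lengthLattice cs (by omega)))
      (klGen_mul_smul_mem_lengthLattice cs hM i hd)
  obtain ⟨c, hc, d', hd', hcd⟩ := exists_bar_eq_of_mem_lengthLattice cs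
    (fun y hy => ih _ (hn ▸ hy) y rfl) hmem
  have hgen : bar M (heckeGen M i + v • 1) = heckeGen M i + v • 1 := by
    rw [map_add, bar_heckeGen_eq, bar_smul, map_one, invert_T, sub_smul]
    abel
  refine ⟨(heckeGen M i + v • 1) * C - c, by rw [map_sub, map_mul, hgen, hC, hc], -d',
    neg_mem hd', ?_⟩
  rw [e, hcd, smul_neg]
  abel

theorem IsTriangularKLElement.isKLElement {w : W} {C : HeckeAlgebra M}
    (h : IsTriangularKLElement cs w C) : IsKLElement cs w C := by
  obtain ⟨hb, d, hd, rfl⟩ := h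
  obtain ⟨q, hq⟩ := exists_finsupp_of_mem_lengthLattice cs hd
  exact ⟨hb, q, by rw [hq]⟩

/-- By uniqueness, the chosen Kazhdan-Lusztig element is the one constructed by induction on the
length, so that it is triangular with respect to the length. -/
theorem klBasis_sub_stdBasis_mem (hM : M.IsCrystallographic) (w : W) :
    klBasis cs w - stdBasis cs w ∈ lengthFiltration cs (cs.length w) := by
  obtain ⟨C, hC⟩ := exists_isTriangularKLElement cs hM w
  have h : IsKLElement cs w (klBasis cs w) :=
    Classical.epsilon_spec (p := IsKLElement cs w) ⟨C, hC.isKLElement⟩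
  rw [h.unique cs hM hC.isKLElement]
  obtain ⟨-, d, hd, rfl⟩ := hC
  rw [add_sub_cancel_left]
  exact lengthLattice_le cs (v_smul_mem_lengthLattice cs hd)

theorem klBasis_mem_lengthFiltration (hM : M.IsCrystallographic) (w : W) :
    klBasis cs w ∈ lengthFiltration cs (cs.length w + 1) := by
  rw [← sub_add_cancel (klBasis cs w) (stdBasis cs w)]
  exact add_mem (lengthFiltration_mono cs (Nat.le_succ _) (klBasis_sub_stdBasis_mem cs hM w))
    (stdBasis_mem_lengthFiltration cs (Nat.lt_succ_self _))

theorem lengthFiltration_le_span_klBasis (hM : M.IsCrystallographic) (n : ℕ) :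
    lengthFiltration cs n ≤
      Submodule.span LaurentRing (klBasis cs '' {y : W | cs.length y < n}) := by
  induction n with
  | zero => simp [lengthFiltration]
  | succ n ih =>
    refine Submodule.span_le.mpr ?_
    rintro _ ⟨y, hy, rfl⟩
    rw [Set.mem_ofPred_eq] at hy
    rw [SetLike.mem_coe, ← sub_sub_cancel (klBasis cs y) (stdBasis cs y)]
    refine sub_mem (Submodule.subset_span ⟨y, hy, rfl⟩) (Submodule.span_mono
      (Set.image_mono fun z (hz : cs.length z < n) => hz.trans n.lt_succ_self) (ih ?_))
    exact lengthFiltration_mono cs (by omega) (klBasis_sub_stdBasis_mem cs hM y)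

theorem span_range_klBasis (hM : M.IsCrystallographic) :
    Submodule.span LaurentRing (Set.range (klBasis cs)) = ⊤ := by
  rw [eq_top_iff, ← span_range_stdBasis cs hM, Submodule.span_le]
  rintro _ ⟨y, rfl⟩
  exact Submodule.span_mono (Set.image_subset_range _ _) (lengthFiltration_le_span_klBasis cs hM _
    (stdBasis_mem_lengthFiltration cs (Nat.lt_succ_self _)))

/-! ### Left ideals generated by Kazhdan-Lusztig elements -/

/-- If `ℓ(aw) = ℓ(a) + ℓ(w)`, then `H̲_a H̲_w` is `H̲_{aw}` up to terms of smaller length. -/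
theorem klBasis_mul_klBasis_sub_mem (hM : M.IsCrystallographic) {a w : W}
    (h : cs.length (a * w) = cs.length a + cs.length w) :
    klBasis cs a * klBasis cs w - klBasis cs (a * w) ∈ lengthFiltration cs (cs.length (a * w)) := by
  have e : klBasis cs a * klBasis cs w - klBasis cs (a * w) =
      stdBasis cs a * (klBasis cs w - stdBasis cs w) +
        (klBasis cs a - stdBasis cs a) * klBasis cs w -
        (klBasis cs (a * w) - stdBasis cs (a * w)) := by
    rw [← stdBasis_mul_of_length cs hM h, mul_sub, sub_mul]
    abel
  rw [e]
  refine sub_mem ?_ (klBasis_sub_stdBasis_mem cs hM _)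
  rw [h]
  exact add_mem (stdBasis_mul_mem_lengthFiltration cs hM a (klBasis_sub_stdBasis_mem cs hM w))
    (mul_mem_lengthFiltration cs hM (klBasis_sub_stdBasis_mem cs hM a)
      (klBasis_mem_lengthFiltration cs hM w))

/-- The left ideal generated by `H̲_w` is always contained in the span of all `H̲_x` with
`x ≥_L w`. -/
theorem span_klBasis_le_leftSpan (hM : M.IsCrystallographic) (w : W) :
    (Ideal.span {klBasis cs w}).restrictScalars LaurentRing ≤ leftSpan cs w := by
  intro x hx
  rw [Submodule.restrictScalars_mem, Ideal.mem_span_singleton'] at hx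
  obtain ⟨h, rfl⟩ := hx
  have hh : h ∈ Submodule.span LaurentRing (Set.range (klBasis cs)) := by
    rw [span_range_klBasis cs hM]
    trivial
  induction hh using Submodule.span_induction with
  | mem x hx =>
    obtain ⟨u, rfl⟩ := hx
    have hu : klBasis cs u * klBasis cs w ∈
        Submodule.span LaurentRing (Set.range (klBasis cs)) := by
      rw [span_range_klBasis cs hM]
      trivial
    obtain ⟨c, hc⟩ := (Finsupp.mem_span_range_iff_exists_finsupp).mp hu
    rw [← hc]
    refine Submodule.sum_mem _ fun y hy => Submodule.smul_mem _ _ (Submodule.subset_span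
      ⟨y, ⟨u, c, ?_, Finsupp.mem_support_iff.mp hy⟩, rfl⟩)
    rw [← hc, Finsupp.linearCombination_apply]
  | zero => simp
  | add x y _ _ hx hy => rw [add_mul]; exact add_mem hx hy
  | smul a x _ hx => rw [smul_mul_assoc]; exact Submodule.smul_mem _ _ hx

/-- If all `x ≥_L w` arise from `w` by reduced left multiplication, then a triangular system of
equations expresses their Kazhdan-Lusztig elements through the products `H̲_a H̲_w`. -/
theorem leftSpan_le_span_klBasis (hM : M.IsCrystallographic) {w : W}
    (hw : {x : W | LeftLE cs w x} ⊆
      {y : W | ∃ a : W, y = a * w ∧ cs.length (a * w) = cs.length a + cs.length w}) :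
    leftSpan cs w ≤ (Ideal.span {klBasis cs w}).restrictScalars LaurentRing := by
  classical
  set I := (Ideal.span {klBasis cs w}).restrictScalars LaurentRing
  have key : ∀ n, ∀ x, LeftLE cs w x → cs.length x = n → klBasis cs x ∈ I := by
    intro n
    induction n using Nat.strong_induction_on with
    | _ n ih =>
    intro x hx hn
    obtain ⟨a, rfl, ha⟩ := hw hx
    obtain ⟨c, hcs, hc⟩ := (Finsupp.mem_span_image_iff_linearCombination LaurentRing).mp
      (lengthFiltration_le_span_klBasis cs hM _ (klBasis_mul_klBasis_sub_mem cs hM ha))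
    have hlt : ∀ y ∈ c.support, cs.length y < cs.length (a * w) := fun y hy => hcs hy
    -- The coefficients of `H̲_a H̲_w` below `a w` are those of `c`, so their indices are `≥_L w`.
    have hle : ∀ y ∈ c.support, LeftLE cs w y := by
      intro y hy
      refine ⟨a, c + Finsupp.single (a * w) 1, ?_, ?_⟩
      · rw [map_add, hc, Finsupp.linearCombination_single, one_smul, sub_add_cancel]
      · have hne : y ≠ a * w := by
          rintro rfl
          exact lt_irrefl _ (hlt _ hy)
        rw [Finsupp.add_apply, Finsupp.single_eq_of_ne hne, add_zero]
        exact Finsupp.mem_support_iff.mp hy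
    have hprod : klBasis cs a * klBasis cs w ∈ I :=
      Ideal.mul_mem_left _ _ (Ideal.subset_span rfl)
    rw [← sub_sub_cancel (klBasis cs a * klBasis cs w) (klBasis cs (a * w)), ← hc]
    refine sub_mem hprod ?_
    rw [Finsupp.linearCombination_apply]
    exact Submodule.sum_mem _ fun y hy =>
      Submodule.smul_mem _ _ (ih _ (hn ▸ hlt y hy) y (hle y hy) rfl)
  refine Submodule.span_le.mpr ?_
  rintro _ ⟨x, hx, rfl⟩
  exact key _ x hx rfl

end KazhdanLusztig

/-- `W` ranges over the finite Weyl groups, that is, the finite Coxeter groups all of whose Coxeter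
matrix entries lie in `{1, 2, 3, 4, 6}`. -/
theorem corollary3 {B W : Type*} [Group W] [Finite W] {M : CoxeterMatrix B}
    (hM : ∀ i j : B, M i j ∈ ({1, 2, 3, 4, 6} : Set ℕ))
    (cs : CoxeterSystem M W) (w : W)
    (hw : {x : W | KazhdanLusztig.LeftLE cs w x} =
      {y : W | ∃ a : W, y = a * w ∧ cs.length (a * w) = cs.length a + cs.length w}) :
    (Ideal.span {KazhdanLusztig.klBasis cs w}).restrictScalars KazhdanLusztig.LaurentRing =
      KazhdanLusztig.leftSpan cs w :=
  le_antisymm (KazhdanLusztig.span_klBasis_le_leftSpan cs hM w)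
    (KazhdanLusztig.leftSpan_le_span_klBasis cs hM hw.subset)
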